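/- **Setting.** Let $k\ge 1$ and let $\Lambda$ be a nonempty row-finite $k$-graph without sources: a countable small category with a degree functor $d:\Lambda\to\mathbb N^k$ such that every morphism $\lambda$ with $d(\lambda)=m+n$ factors uniquely as $\lambda=\lambda'\lambda''$ with $d(\lambda')=m$, $d(\lambda'')=n$, and such that for every vertex $v$ and every $n\in\mathbb N^k$ the set $v\Lambda^n=\{\lambda: r(\lambda)=v,\ d(\lambda)=n\}$ is finite and nonempty. Vertices are identified with identity morphisms, i.e. with the morphisms of degree $0$. Let $\Lambda^\infty$ be the infinite path space, i.e. the set of degree-preserving functors $x:\Omega_k\to\Lambda$, where $\Omega_k$ has objects $\mathbb N^k$ and morphisms $(p,q)$, $p\le q$, with range $p$, source $q$ and degree $q-p$. It carries the topology generated by the cylinder sets $Z(\lambda)=\{x: x(0,d(\lambda))=\lambda\}$ and its Borel $\sigma$-algebra. Let $\sigma^n(x)(p,q)=x(p+n,q+n)$ be the shift maps (the coding maps) and $\sigma_\lambda:Z(s(\lambda))\to Z(\lambda)$, $\sigma_\lambda(x)=\lambda x$, the prefixing maps. Let $\mu$ be a Radon measure on $\Lambda^\infty$, finite on all cylinder sets,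 and let $\{f_\lambda\}_{\lambda\in\Lambda}\subseteq L^2(\Lambda^\infty,\mu)$ be functions $\Lambda^\infty\to\mathbb C$ such that the sets $D_\lambda=Z(s(\lambda))$, the maps $\sigma_\lambda$, $\sigma^n$ and the functions $f_\lambda$ form a $\Lambda$-projective system on $(\Lambda^\infty,\mu)$. That is: * they form a $\Lambda$-semibranching function system: with $R_\lambda=\sigma_\lambda(D_\lambda)$, we have $0<\mu(D_\lambda)<\infty$ and $\mu(R_\lambda)<\infty$; for each $m\in\mathbb N^k$ the sets $R_\lambda$ with $d(\lambda)=m$ are pairwise disjoint up to null sets and cover $\Lambda^\infty$ up to a null set; $\mu\circ\sigma_\lambda$ has a Radon–Nikodym derivative with respect to $\mu$ on $D_\lambda$ that is strictly positive a.e. on $D_\lambda$; $\sigma^{d(\lambda)}\circ\sigma_\lambda=\mathrm{id}_{D_\lambda}$; $\sigma_v=\mathrm{id}$ on $D_v$ for every vertex $v$; if $s(\lambda)=r(\nu)$, then $R_\nu\subseteq D_\lambda$ up to a null set and $\sigma_\lambda\sigma_\nu=\sigma_{\lambda\nu}$ a.e.; and $\sigma^m\circ\sigma^n=\sigma^{m+n}$;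 * $0\ne \dfrac{d(\mu\circ\sigma_\lambda^{-1})}{d\mu}=|f_\lambda|^2$ for all $\lambda$, where $(\mu\circ\sigma_\lambda^{-1})(B)=\mu(\sigma_\lambda^{-1}(B))$; * $f_\lambda\cdot(f_\nu\circ\sigma^{d(\lambda)})=f_{\lambda\nu}$ a.e. whenever $s(\lambda)=r(\nu)$. Let $E\subseteq\Lambda^\infty$ be a Borel set with $\mu\big((\sigma^n)^{-1}(E)\,\Delta\,E\big)=0$ for all $n\in\mathbb N^k$ and $\mu(E\cap Z(v))\neq0$ for every vertex $v$. Write $\mu_E=\mu(\,\cdot\cap E)$. Say that a map $T$ on a measure space $(X,\nu)$ is *ergodic* if every measurable $A$ with $\nu(A\,\Delta\,T^{-1}(A))=0$ satisfies $\nu(A)=0$ or $\nu(X\setminus A)=0$, and that a family $\{T_i\}$ is *jointly ergodic* if this holds for every measurable $A$ with $\nu(A\,\Delta\,T_i^{-1}(A))=0$ for all $i$. A family of bounded operators on a Hilbert space $H$ is *irreducible* if $H\ne0$ and the only closed subspaces invariant under all the operators and all their adjoints are $0$ and $H$. **Theorem.** For each $\lambda\in\Lambda$ the formula $$T^E_\lambda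 g=f_\lambda\cdot(g\circ\sigma^{d(\lambda)})$$ defines a bounded operator on $L^2(\Lambda^\infty,\mu_E)$, and: * **(a)** The commutant of $\{T^E_\lambda:\lambda\in\Lambda\}$ is exactly the set of multiplication operators $M_h$ by functions $h\in L^\infty(\Lambda^\infty,\mu_E)$ such that $h\circ\sigma^n=h$ $\mu_E$-a.e. for all $n\in\mathbb N^k$. The commutant of $\{T^E_\lambda,(T^E_\lambda)^*:\lambda\in\Lambda\}$ is the same set. * **(b)** If $\sigma^n$ is ergodic with respect to $\mu_E$ for some $n\in\mathbb N^k$, then $\{T^E_\lambda\}_{\lambda\in\Lambda}$ is irreducible. * **(c)** If the family $\{\sigma^n\}_{n\in\mathbb N^k}$ is jointly ergodic with respect to $\mu_E$, then $\{T^E_\lambda\}_{\lambda\in\Lambda}$ is irreducible. -/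

import Mathlib

open MeasureTheory Set
open scoped ENNReal symmDiff

universe u v

/-- A higher-rank graph of rank `k`: a countable small category with a degree functor to `ℕ^k`
that has the factorization property. The category is given in the arrows-only picture: `Mor` is the
set of morphisms, objects are identified with their identity morphisms, `r l` and `s l` are the
(identity morphisms of the) range and source of `l`, and `comp l m h`, the product `lm`, is defined
when `s l = r m`. -/
structure KGraph (k : ℕ) where
  Mor : Type u
  countable_mor : Countable Mor
  r : Mor → Mor
  s : Mor → Mor
  comp : ∀ l m : Mor, s l = r m → Mor
  r_r : ∀ l, r (r l) = r l
  s_r : ∀ l, s (r l) = r l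
  r_s : ∀ l, r (s l) = s l
  s_s : ∀ l, s (s l) = s l
  r_comp : ∀ l m h, r (comp l m h) = r l
  s_comp : ∀ l m h, s (comp l m h) = s m
  id_comp : ∀ l, comp (r l) l (s_r l) = l
  comp_id : ∀ l, comp l (s l) (r_s l).symm = l
  assoc : ∀ l m n (h₁ : s l = r m) (h₂ : s m = r n),
    comp (comp l m h₁) n ((s_comp l m h₁).trans h₂) =
      comp l (comp m n h₂) (h₁.trans (r_comp m n h₂).symm)
  d : Mor → Fin k → ℕ
  d_comp : ∀ l m h, d (comp l m h) = d l + d m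
  factorization : ∀ (l : Mor) (m n : Fin k → ℕ), d l = m + n →
    ∃! p : Mor × Mor, d p.1 = m ∧ d p.2 = n ∧ ∃ h : s p.1 = r p.2, comp p.1 p.2 h = l

namespace KGraph

variable {k : ℕ}

/-- The vertices `Λ^0`: the morphisms of degree zero, which are exactly the identities
(see `d_r` and `isVertex_eq`). -/
def IsVertex (Λ : KGraph.{u} k) (v : Λ.Mor) : Prop := Λ.d v = 0

/-- `v Λ^n` is finite for all vertices `v` and all `n`. -/
def RowFinite (Λ : KGraph.{u} k) : Prop :=
  ∀ v, Λ.IsVertex v → ∀ n : Fin k → ℕ, {l | Λ.r l = v ∧ Λ.d l = n}.Finite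

/-- `v Λ^n` is nonempty for all vertices `v` and all `n`. -/
def SourceFree (Λ : KGraph.{u} k) : Prop :=
  ∀ v, Λ.IsVertex v → ∀ n : Fin k → ℕ, {l | Λ.r l = v ∧ Λ.d l = n}.Nonempty

/-! ### Identities and factorizations -/

theorem d_r (Λ : KGraph.{u} k) (l : Λ.Mor) : Λ.d (Λ.r l) = 0 := by
  have h := Λ.d_comp (Λ.r l) l (Λ.s_r l)
  rw [Λ.id_comp] at h
  exact left_eq_add.mp (h.trans (add_comm _ _))

theorem d_s (Λ : KGraph.{u} k) (l : Λ.Mor) : Λ.d (Λ.s l) = 0 := by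
  rw [← Λ.r_s]; exact Λ.d_r _

theorem comp_inj (Λ : KGraph.{u} k) {a b a' b' : Λ.Mor} {h : Λ.s a = Λ.r b}
    {h' : Λ.s a' = Λ.r b'} (e : Λ.comp a b h = Λ.comp a' b' h') (hd : Λ.d a = Λ.d a') :
    a = a' ∧ b = b' := by
  have h1 := Λ.d_comp a b h
  have h2 : Λ.d b' = Λ.d b := by
    have h3 := Λ.d_comp a' b' h'
    rw [← e, h1, hd] at h3
    exact (add_left_cancel h3).symm
  have := (Λ.factorization _ _ _ h1).unique (y₁ := (a, b)) (y₂ := (a', b'))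
    ⟨rfl, rfl, h, rfl⟩ ⟨hd.symm, h2, h', e.symm⟩
  exact ⟨congrArg Prod.fst this, congrArg Prod.snd this⟩

theorem isVertex_eq (Λ : KGraph.{u} k) {v : Λ.Mor} (hv : Λ.IsVertex v) :
    Λ.r v = v ∧ Λ.s v = v := by
  have e : Λ.comp (Λ.r v) v (Λ.s_r v) = Λ.comp v (Λ.s v) (Λ.r_s v).symm := by
    rw [Λ.id_comp, Λ.comp_id]
  obtain ⟨h1, h2⟩ := Λ.comp_inj e ((Λ.d_r v).trans hv.symm)
  exact ⟨h1, h2.symm⟩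

theorem exists_factor (Λ : KGraph.{u} k) (l : Λ.Mor) (n : Fin k → ℕ) (hn : n ≤ Λ.d l) :
    ∃ p : Λ.Mor × Λ.Mor, Λ.d p.1 = n ∧ Λ.d p.2 = Λ.d l - n ∧
      ∃ h : Λ.s p.1 = Λ.r p.2, Λ.comp p.1 p.2 h = l :=
  (Λ.factorization l n (Λ.d l - n) (add_tsub_cancel_of_le hn).symm).exists

/-- The initial segment `l(0, n)` of `l`. -/
noncomputable def head (Λ : KGraph.{u} k) (l : Λ.Mor) (n : Fin k → ℕ) (hn : n ≤ Λ.d l) : Λ.Mor :=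
  (Λ.exists_factor l n hn).choose.1

/-- The final segment `l(n, d(l))` of `l`. -/
noncomputable def tail (Λ : KGraph.{u} k) (l : Λ.Mor) (n : Fin k → ℕ) (hn : n ≤ Λ.d l) : Λ.Mor :=
  (Λ.exists_factor l n hn).choose.2

theorem d_head (Λ : KGraph.{u} k) (l : Λ.Mor) (n : Fin k → ℕ) (hn : n ≤ Λ.d l) :
    Λ.d (Λ.head l n hn) = n := (Λ.exists_factor l n hn).choose_spec.1

theorem d_tail (Λ : KGraph.{u} k) (l : Λ.Mor) (n : Fin k → ℕ) (hn : n ≤ Λ.d l) :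
    Λ.d (Λ.tail l n hn) = Λ.d l - n := (Λ.exists_factor l n hn).choose_spec.2.1

theorem s_head (Λ : KGraph.{u} k) (l : Λ.Mor) (n : Fin k → ℕ) (hn : n ≤ Λ.d l) :
    Λ.s (Λ.head l n hn) = Λ.r (Λ.tail l n hn) :=
  (Λ.exists_factor l n hn).choose_spec.2.2.choose

theorem head_comp_tail (Λ : KGraph.{u} k) (l : Λ.Mor) (n : Fin k → ℕ) (hn : n ≤ Λ.d l) :
    Λ.comp (Λ.head l n hn) (Λ.tail l n hn) (Λ.s_head l n hn) = l :=
  (Λ.exists_factor l n hn).choose_spec.2.2.choose_spec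

theorem head_eq (Λ : KGraph.{u} k) {l a b : Λ.Mor} {n : Fin k → ℕ} (hn : n ≤ Λ.d l)
    (h : Λ.s a = Λ.r b) (e : Λ.comp a b h = l) (ha : Λ.d a = n) :
    Λ.head l n hn = a ∧ Λ.tail l n hn = b :=
  Λ.comp_inj ((Λ.head_comp_tail l n hn).trans e.symm) ((Λ.d_head l n hn).trans ha.symm)

theorem head_of_comp (Λ : KGraph.{u} k) (a b : Λ.Mor) (h : Λ.s a = Λ.r b) (n : Fin k → ℕ)
    (hn : n ≤ Λ.d a) (hn' : n ≤ Λ.d (Λ.comp a b h)) :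
    Λ.head (Λ.comp a b h) n hn' = Λ.head a n hn := by
  have h1 : Λ.s (Λ.tail a n hn) = Λ.r b := by
    rw [← h]
    conv_rhs => rw [← Λ.head_comp_tail a n hn]
    rw [Λ.s_comp]
  refine (Λ.head_eq hn' (b := Λ.comp (Λ.tail a n hn) b h1) ?_ ?_ (Λ.d_head a n hn)).1
  · rw [Λ.r_comp]; exact Λ.s_head a n hn
  · rw [← Λ.assoc _ _ _ (Λ.s_head a n hn) h1]
    congr 1
    exact Λ.head_comp_tail a n hn

/-! ### Infinite paths -/

/-- A morphism of `k`-graphs: a degree-preserving functor. -/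
@[ext]
structure Hom (Γ : KGraph.{v} k) (Λ : KGraph.{u} k) where
  map : Γ.Mor → Λ.Mor
  map_r : ∀ l, map (Γ.r l) = Λ.r (map l)
  map_s : ∀ l, map (Γ.s l) = Λ.s (map l)
  map_comp : ∀ l m (h : Γ.s l = Γ.r m), map (Γ.comp l m h) =
    Λ.comp (map l) (map m) ((map_s l).symm.trans ((congrArg map h).trans (map_r m)))
  map_d : ∀ l, Λ.d (map l) = Γ.d l

/-- The `k`-graph `Ω_k`: its objects are the elements of `ℕ^k`, its morphisms the pairs `(m, n)`
with `m ≤ n`; the range of `(m, n)` is `m`, its source is `n`, and `d(m, n) = n - m`. -/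
def Omega (k : ℕ) : KGraph.{0} k where
  Mor := {p : (Fin k → ℕ) × (Fin k → ℕ) // p.1 ≤ p.2}
  countable_mor := inferInstance
  r p := ⟨(p.1.1, p.1.1), le_rfl⟩
  s p := ⟨(p.1.2, p.1.2), le_rfl⟩
  comp p q h := ⟨(p.1.1, q.1.2),
    p.2.trans ((congrArg (fun t => t.1.1) h).le.trans q.2)⟩
  r_r _ := rfl
  s_r _ := rfl
  r_s _ := rfl
  s_s _ := rfl
  r_comp _ _ _ := rfl
  s_comp _ _ _ := rfl
  id_comp _ := rfl
  comp_id _ := rfl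
  assoc _ _ _ _ _ := rfl
  d p := p.1.2 - p.1.1
  d_comp := by
    rintro ⟨⟨a, b⟩, hab⟩ ⟨⟨c, e⟩, hce⟩ h
    have h' : b = c := congrArg (fun t => t.1.1) h
    subst h'
    funext i
    have h1 := hab i
    have h2 := hce i
    simp only [Pi.sub_apply, Pi.add_apply] at *
    omega
  factorization := by
    rintro ⟨⟨a, b⟩, hab⟩ m n hd
    have hb : b = a + m + n := by
      rw [add_assoc]
      exact (tsub_eq_iff_eq_add_of_le hab).1 hd |>.trans (add_comm _ _)
    refine ⟨(⟨(a, a + m), le_self_add⟩, ⟨(a + m, b), hb ▸ le_self_add⟩),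
      ⟨add_tsub_cancel_left a m, ?_, rfl, rfl⟩, ?_⟩
    · exact (congrArg (fun t => t - (a + m)) hb).trans (add_tsub_cancel_left _ _)
    · rintro ⟨⟨⟨a', c⟩, h1⟩, ⟨⟨c', b'⟩, h2⟩⟩ ⟨hm, -, h, e⟩
      have hc : c = c' := congrArg (fun t => t.1.1) h
      have ha : a' = a := congrArg (fun t => t.1.1) e
      have hb' : b' = b := congrArg (fun t => t.1.2) e
      subst hc ha hb'
      have : c = a' + m := ((tsub_eq_iff_eq_add_of_le h1).1 hm).trans (add_comm _ _)
      subst this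
      rfl

/-- The infinite path space `Λ^∞`. -/
def InfPath (Λ : KGraph.{u} k) : Type u := Hom (Omega k) Λ

/-- `x(p, q)`. -/
def InfPath.seg {Λ : KGraph.{u} k} (x : Λ.InfPath) (p q : Fin k → ℕ) (h : p ≤ q) : Λ.Mor :=
  Hom.map x ⟨(p, q), h⟩

theorem InfPath.ext {Λ : KGraph.{u} k} {x y : Λ.InfPath}
    (h : ∀ p q hpq, x.seg p q hpq = y.seg p q hpq) : x = y :=
  Hom.ext (funext fun l => h l.1.1 l.1.2 l.2)

theorem InfPath.r_seg {Λ : KGraph.{u} k} (x : Λ.InfPath) (p q : Fin k → ℕ) (h : p ≤ q) :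
    Λ.r (x.seg p q h) = x.seg p p le_rfl := (Hom.map_r x ⟨(p, q), h⟩).symm

theorem InfPath.s_seg {Λ : KGraph.{u} k} (x : Λ.InfPath) (p q : Fin k → ℕ) (h : p ≤ q) :
    Λ.s (x.seg p q h) = x.seg q q le_rfl := (Hom.map_s x ⟨(p, q), h⟩).symm

theorem InfPath.d_seg {Λ : KGraph.{u} k} (x : Λ.InfPath) (p q : Fin k → ℕ) (h : p ≤ q) :
    Λ.d (x.seg p q h) = q - p := Hom.map_d x ⟨(p, q), h⟩

theorem InfPath.seg_comp {Λ : KGraph.{u} k} (x : Λ.InfPath) (p q t : Fin k → ℕ) (h : p ≤ q)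
    (h' : q ≤ t) (e : Λ.s (x.seg p q h) = Λ.r (x.seg q t h')) :
    Λ.comp (x.seg p q h) (x.seg q t h') e = x.seg p t (h.trans h') :=
  (Hom.map_comp x ⟨(p, q), h⟩ ⟨(q, t), h'⟩ rfl).symm

/-- The cylinder set `Z(l)` of the infinite paths `x` with `x(0, d(l)) = l`. -/
def cylinder (Λ : KGraph.{u} k) (l : Λ.Mor) : Set Λ.InfPath :=
  {x | x.seg 0 (Λ.d l) zero_le = l}

/-- The shift map `σ^m`, with `σ^m(x)(p, q) = x(p + m, q + m)`. -/
def shift (Λ : KGraph.{u} k) (m : Fin k → ℕ) (x : Λ.InfPath) : Λ.InfPath where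
  map l := x.seg (l.1.1 + m) (l.1.2 + m) (add_le_add_left l.2 m)
  map_r l := (x.r_seg _ _ _).symm
  map_s l := (x.s_seg _ _ _).symm
  map_comp := by
    rintro ⟨⟨a, b⟩, hab⟩ ⟨⟨c, e⟩, hce⟩ h
    have h' : b = c := congrArg (fun t => t.1.1) h
    subst h'
    exact (x.seg_comp _ _ _ _ _ _).symm
  map_d l := by
    rw [x.d_seg]
    exact add_tsub_add_eq_tsub_right _ _ _

/-- The infinite path `x` with `x(p, q) = c(q)(p, q)`, for a compatible family of paths `c(q)` of
degree `q`. -/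
noncomputable def ofHeads (Λ : KGraph.{u} k) (c : (Fin k → ℕ) → Λ.Mor) (hd : ∀ q, Λ.d (c q) = q)
    (hc : ∀ p q (h : p ≤ q), Λ.head (c q) p (h.trans (hd q).ge) = c p) : Λ.InfPath :=
  have hr : ∀ p q (h : p ≤ q), Λ.r (Λ.tail (c q) p (h.trans (hd q).ge)) = Λ.s (c p) := by
    intro p q h
    rw [← Λ.s_head, hc p q h]
  have hid : ∀ p, Λ.tail (c p) p (hd p).ge = Λ.s (c p) := fun p =>
    (Λ.head_eq (hd p).ge (Λ.r_s _).symm (Λ.comp_id (c p)) (hd p)).2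
  have hs : ∀ p q (h : p ≤ q), Λ.s (Λ.tail (c q) p (h.trans (hd q).ge)) = Λ.s (c q) := by
    intro p q h
    conv_rhs => rw [← Λ.head_comp_tail (c q) p (h.trans (hd q).ge)]
    rw [Λ.s_comp]
  { map := fun l => Λ.tail (c l.1.2) l.1.1 (l.2.trans (hd _).ge)
    map_r := fun l => (hid l.1.1).trans (hr _ _ l.2).symm
    map_s := fun l => (hid l.1.2).trans (hs _ _ l.2).symm
    map_comp := by
      rintro ⟨⟨a, b⟩, hab⟩ ⟨⟨b', e⟩, hbe⟩ h
      have h' : b = b' := congrArg (fun t => t.1.1) h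
      subst h'
      change a ≤ b at hab
      change b ≤ e at hbe
      have h1 : Λ.s (Λ.tail (c b) a (hab.trans (hd b).ge)) =
          Λ.r (Λ.tail (c e) b (hbe.trans (hd e).ge)) := (hs a b hab).trans (hr b e hbe).symm
      have h2 : Λ.s (c a) = Λ.r (Λ.tail (c b) a (hab.trans (hd b).ge)) := (hr a b hab).symm
      have e1 : Λ.comp (c a) _ h2 = c b := by
        have := Λ.head_comp_tail (c b) a (hab.trans (hd b).ge)
        simpa only [hc a b hab] using this
      have e2 : Λ.comp (c b) _ (hr b e hbe).symm = c e := by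
        have := Λ.head_comp_tail (c e) b (hbe.trans (hd e).ge)
        simpa only [hc b e hbe] using this
      refine (Λ.head_eq (l := c e) (n := a) (a := c a) _
        (b := Λ.comp _ _ h1) (by rw [Λ.r_comp]; exact h2) ?_ (hd a)).2
      rw [← Λ.assoc _ _ _ h2 h1]
      simp only [e1, e2]
    map_d := fun l => (Λ.d_tail _ _ _).trans (by rw [hd]; rfl) }

theorem ofHeads_seg_zero (Λ : KGraph.{u} k) (c : (Fin k → ℕ) → Λ.Mor) (hd : ∀ q, Λ.d (c q) = q)
    (hc : ∀ p q (h : p ≤ q), Λ.head (c q) p (h.trans (hd q).ge) = c p) (q : Fin k → ℕ) :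
    (Λ.ofHeads c hd hc).seg 0 q zero_le = c q :=
  (Λ.head_eq ((zero_le).trans (hd q).ge) (Λ.s_r _) (Λ.id_comp (c q)) (Λ.d_r _)).2

/-- The path `l x(0, q)`. -/
def extend (Λ : KGraph.{u} k) (l : Λ.Mor) (x : Λ.InfPath) (hx : x ∈ Λ.cylinder (Λ.s l))
    (q : Fin k → ℕ) : Λ.Mor :=
  Λ.comp l (x.seg 0 q zero_le) (by
    have h : x.seg 0 (Λ.d (Λ.s l)) zero_le = Λ.s l := hx
    rw [x.r_seg 0 q, ← x.r_seg 0 (Λ.d (Λ.s l)) zero_le, h, Λ.r_s])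

theorem d_extend (Λ : KGraph.{u} k) (l : Λ.Mor) (x : Λ.InfPath) (hx : x ∈ Λ.cylinder (Λ.s l))
    (q : Fin k → ℕ) : Λ.d (Λ.extend l x hx q) = Λ.d l + q := by
  rw [extend, Λ.d_comp, x.d_seg, tsub_zero]

theorem le_d_extend (Λ : KGraph.{u} k) (l : Λ.Mor) (x : Λ.InfPath) (hx : x ∈ Λ.cylinder (Λ.s l))
    (q : Fin k → ℕ) : q ≤ Λ.d (Λ.extend l x hx q) :=
  (Λ.d_extend l x hx q).symm ▸ le_add_self

theorem head_extend (Λ : KGraph.{u} k) (l : Λ.Mor) (x : Λ.InfPath) (hx : x ∈ Λ.cylinder (Λ.s l))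
    (p q n : Fin k → ℕ) (h : p ≤ q) (hp : n ≤ Λ.d (Λ.extend l x hx p))
    (hq : n ≤ Λ.d (Λ.extend l x hx q)) :
    Λ.head (Λ.extend l x hx q) n hq = Λ.head (Λ.extend l x hx p) n hp := by
  have h1 : Λ.s (x.seg 0 p zero_le) = Λ.r (x.seg p q h) := by rw [x.s_seg, x.r_seg]
  have h2 : Λ.s (Λ.extend l x hx p) = Λ.r (x.seg p q h) := by rw [extend, Λ.s_comp, h1]
  have e : Λ.comp (Λ.extend l x hx p) (x.seg p q h) h2 = Λ.extend l x hx q := by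
    have := x.seg_comp 0 p q zero_le h h1
    unfold extend
    rw [Λ.assoc _ _ _ _ h1]
    simp only [this]
  have := Λ.head_of_comp (Λ.extend l x hx p) (x.seg p q h) h2 n hp (by rw [e]; exact hq)
  simpa only [e] using this

/-- The infinite path `lx`, for `x ∈ Z(s(l))`: its segment `(lx)(p, q)` is the segment of the finite
path `l x(0, q)` from `p` to `q`. -/
noncomputable def concat (Λ : KGraph.{u} k) (l : Λ.Mor) (x : Λ.InfPath)
    (hx : x ∈ Λ.cylinder (Λ.s l)) : Λ.InfPath :=
  Λ.ofHeads (fun q => Λ.head (Λ.extend l x hx q) q (Λ.le_d_extend l x hx q))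
    (fun _ => Λ.d_head _ _ _) (by
      intro p q h
      have hq := Λ.le_d_extend l x hx q
      rw [← Λ.head_extend l x hx p q p h (Λ.le_d_extend l x hx p) (h.trans hq)]
      have := Λ.head_of_comp _ _ (Λ.s_head _ q hq) p (h.trans (Λ.d_head _ q hq).ge)
        (by rw [Λ.head_comp_tail]; exact h.trans hq)
      simpa only [Λ.head_comp_tail] using this.symm)

theorem concat_mem (Λ : KGraph.{u} k) (l : Λ.Mor) (x : Λ.InfPath)
    (hx : x ∈ Λ.cylinder (Λ.s l)) : Λ.concat l x hx ∈ Λ.cylinder l :=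
  (Λ.ofHeads_seg_zero _ _ _ _).trans (Λ.head_eq (Λ.le_d_extend l x hx _) _ rfl rfl).1

theorem shift_concat (Λ : KGraph.{u} k) (l : Λ.Mor) (x : Λ.InfPath)
    (hx : x ∈ Λ.cylinder (Λ.s l)) : Λ.shift (Λ.d l) (Λ.concat l x hx) = x := by
  refine InfPath.ext fun p q h => ?_
  have key : ∀ n : Fin k → ℕ,
      Λ.head (Λ.extend l x hx (n + Λ.d l)) (n + Λ.d l) (Λ.le_d_extend l x hx _) =
        Λ.extend l x hx n := by
    intro n
    have hn : n + Λ.d l ≤ Λ.d (Λ.extend l x hx n) := by rw [Λ.d_extend, add_comm]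
    rw [Λ.head_extend l x hx n (n + Λ.d l) (n + Λ.d l) le_self_add hn]
    exact (Λ.head_eq hn (Λ.r_s _).symm (Λ.comp_id _) (by rw [Λ.d_extend, add_comm])).1
  have h1 : Λ.s (x.seg 0 p zero_le) = Λ.r (x.seg p q h) := by rw [x.s_seg, x.r_seg]
  have h2 : Λ.s (Λ.extend l x hx p) = Λ.r (x.seg p q h) := by rw [extend, Λ.s_comp, h1]
  have e : Λ.comp (Λ.extend l x hx p) (x.seg p q h) h2 = Λ.extend l x hx q := by
    have := x.seg_comp 0 p q zero_le h h1
    unfold extend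
    rw [Λ.assoc _ _ _ _ h1]
    simp only [this]
  have hn : p + Λ.d l ≤
      Λ.d (Λ.head (Λ.extend l x hx (q + Λ.d l)) (q + Λ.d l) (Λ.le_d_extend l x hx _)) := by
    rw [Λ.d_head]
    exact add_le_add_left h _
  exact (Λ.head_eq hn h2 (e.trans (key q).symm) (by rw [Λ.d_extend, add_comm])).2

open Classical in
/-- The prefixing map `σ_l : Z(s(l)) → Z(l)`, `x ↦ lx`. It is extended by the identity outside of
its domain `Z(s(l))`; these values are irrelevant. -/
noncomputable def prefixMap (Λ : KGraph.{u} k) (l : Λ.Mor) (x : Λ.InfPath) : Λ.InfPath :=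
  if hx : x ∈ Λ.cylinder (Λ.s l) then Λ.concat l x hx else x

/-- The topology of `Λ^∞` generated by the cylinder sets. -/
instance (Λ : KGraph.{u} k) : TopologicalSpace Λ.InfPath :=
  TopologicalSpace.generateFrom (Set.range Λ.cylinder)

/-- The Borel `σ`-algebra of `Λ^∞`. -/
instance (Λ : KGraph.{u} k) : MeasurableSpace Λ.InfPath := borel _

instance (Λ : KGraph.{u} k) : BorelSpace Λ.InfPath := ⟨rfl⟩

end KGraph

/-! ### Semibranching function systems and projective systems -/

/-- The maps `τ i : D i → X` form a semibranching function system on `(X, μ)` with coding map `σ`.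
Only the values of `τ i` on `D i` matter. The function `Φ` is the Radon–Nikodym derivative
of `μ ∘ τ i` with respect to `μ` on `D i`. -/
structure IsSemibranching {X : Type*} [MeasurableSpace X] (μ : Measure X) {ι : Type*}
    (D : ι → Set X) (τ : ι → X → X) (σ : X → X) : Prop where
  countable : Countable ι
  measurableSet_D : ∀ i, MeasurableSet (D i)
  D_pos : ∀ i, 0 < μ (D i)
  D_lt_top : ∀ i, μ (D i) < ∞
  measurable_τ : ∀ i, Measurable ((D i).domRestrict (τ i))
  measurableSet_R : ∀ i, MeasurableSet (τ i '' D i)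
  cover : μ (⋃ i, τ i '' D i)ᶜ = 0
  disjoint : ∀ i j, i ≠ j → μ (τ i '' D i ∩ τ j '' D j) = 0
  R_lt_top : ∀ i, μ (τ i '' D i) < ∞
  rnDeriv_pos : ∀ i, ∃ Φ : X → ℝ≥0∞, Measurable Φ ∧
    (∀ B, MeasurableSet B → B ⊆ D i → μ (τ i '' B) = ∫⁻ x in B, Φ x ∂μ) ∧
    ∀ᵐ x ∂μ, x ∈ D i → 0 < Φ x
  measurable_coding : Measurable σ
  coding : ∀ i, ∀ x ∈ D i, σ (τ i x) = x

/-- `D`, `τ` (prefixing maps) and `σ` (coding maps) form a `Λ`-semibranching function system on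
`(X, μ)`. Only the values of `τ l` on `D l` matter. -/
structure IsLambdaSemibranching {k : ℕ} (Λ : KGraph.{u} k) {X : Type*} [MeasurableSpace X]
    (μ : Measure X) (D : Λ.Mor → Set X) (τ : Λ.Mor → X → X) (σ : (Fin k → ℕ) → X → X) :
    Prop where
  semibranching : ∀ m : Fin k → ℕ,
    IsSemibranching μ (fun l : {l : Λ.Mor // Λ.d l = m} => D l) (fun l => τ l) (σ m)
  vertex : ∀ v, Λ.IsVertex v → ∀ x ∈ D v, τ v x = x
  range_subset : ∀ l m, Λ.s l = Λ.r m → μ ((τ m '' D m) \ D l) = 0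
  domain_comp : ∀ l m (h : Λ.s l = Λ.r m), D (Λ.comp l m h) =ᵐ[μ] D m
  prefix_comp : ∀ l m (h : Λ.s l = Λ.r m),
    ∀ᵐ x ∂μ, x ∈ D m → τ l (τ m x) = τ (Λ.comp l m h) x
  coding_comp : ∀ m n, σ m ∘ σ n = σ (m + n)

/-- `D`, `τ`, `σ` and the functions `f l ∈ L²(X, μ)` form a `Λ`-projective system on `(X, μ)`:
`|f l|²` is nonzero and is the Radon–Nikodym derivative of `μ ∘ (τ l)⁻¹` with respect to `μ`, and
`f l · (f m ∘ σ^{d(l)}) = f (lm)`. -/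
structure IsLambdaProjective {k : ℕ} (Λ : KGraph.{u} k) {X : Type*} [MeasurableSpace X]
    (μ : Measure X) (D : Λ.Mor → Set X) (τ : Λ.Mor → X → X) (σ : (Fin k → ℕ) → X → X)
    (f : Λ.Mor → X → ℂ) : Prop extends IsLambdaSemibranching Λ μ D τ σ where
  memLp : ∀ l, MemLp (f l) 2 μ
  ne_zero : ∀ l, ¬ f l =ᵐ[μ] 0
  rnDeriv : ∀ l B, MeasurableSet B → μ (D l ∩ τ l ⁻¹' B) = ∫⁻ x in B, ‖f l x‖ₑ ^ 2 ∂μ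
  mul : ∀ l m (h : Λ.s l = Λ.r m),
    (fun x => f l x * f m (σ (Λ.d l) x)) =ᵐ[μ] f (Λ.comp l m h)

/-- The operators `T l` on `L²(X, μ)` are those of the system: `T l g = f l · (g ∘ σ^{d(l)})`. -/
def IsLambdaProjectiveRep {k : ℕ} (Λ : KGraph.{u} k) {X : Type*} [MeasurableSpace X]
    (μ : Measure X) (σ : (Fin k → ℕ) → X → X) (f : Λ.Mor → X → ℂ)
    (T : Λ.Mor → (Lp ℂ 2 μ →L[ℂ] Lp ℂ 2 μ)) : Prop :=
  ∀ l (g : Lp ℂ 2 μ), T l g =ᵐ[μ] fun x => f l x * g (σ (Λ.d l) x)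

/-! ### Ergodicity, multiplication operators, irreducibility -/

/-- `A` is invariant for `T` if `μ(T⁻¹(A) Δ A) = 0`. -/
def IsInvariantSet {X : Type*} [MeasurableSpace X] (μ : Measure X) (T : X → X) (A : Set X) : Prop :=
  μ ((T ⁻¹' A) ∆ A) = 0

/-- A family of maps is jointly ergodic if the measurable sets that are invariant for all of them
are null or conull. -/
def IsJointlyErgodic {X : Type*} [MeasurableSpace X] (μ : Measure X) {ι : Type*}
    (T : ι → X → X) : Prop :=
  ∀ A, MeasurableSet A → (∀ i, IsInvariantSet μ (T i) A) → μ A = 0 ∨ μ Aᶜ = 0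

/-- A map is ergodic if its measurable invariant sets are null or conull. (No measure
preservation is required.) -/
def IsErgodicMap {X : Type*} [MeasurableSpace X] (μ : Measure X) (T : X → X) : Prop :=
  ∀ A, MeasurableSet A → IsInvariantSet μ T A → μ A = 0 ∨ μ Aᶜ = 0

/-- The multiplication operators on `L²(X, μ)` by functions `h ∈ L^∞(X, μ)` with `h ∘ σ n = h`
a.e. for all `n`. -/
def invariantMultiplicationOperators {X : Type*} [MeasurableSpace X] (μ : Measure X) {ι : Type*}
    (σ : ι → X → X) : Set (Lp ℂ 2 μ →L[ℂ] Lp ℂ 2 μ) :=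
  {A | ∃ h : X → ℂ, MemLp h ∞ μ ∧ (∀ n, h ∘ σ n =ᵐ[μ] h) ∧
    ∀ g : Lp ℂ 2 μ, A g =ᵐ[μ] fun x => h x * g x}

/-- A family of operators on a Hilbert space `H` is irreducible (that is, the C*-algebra
it generates acts irreducibly) if `H ≠ 0` and the only closed subspaces that are invariant under
all the operators and all their adjoints are `0` and `H`. -/
def IsIrreducibleFamily {H : Type*} [NormedAddCommGroup H] [InnerProductSpace ℂ H]
    [CompleteSpace H] {ι : Type*} (T : ι → (H →L[ℂ] H)) : Prop :=
  Nontrivial H ∧ ∀ K : Submodule ℂ H, IsClosed (K : Set H) →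
    (∀ i, ∀ x ∈ K, T i x ∈ K ∧ ContinuousLinearMap.adjoint (T i) x ∈ K) → K = ⊥ ∨ K = ⊤

/-! ### Square-integrable functions and supports -/

/-! Since `|f l|²` is the density of the image under `σ_l` of `μ` on `Z(s(l))`, and `E` is shift
invariant up to null sets, `T l` is isometric on the functions supported in `Z(s(l))` and kills
those vanishing there (`lintegral_mul_comp_shift_restrict`). Moreover `f l` is nonzero a.e. on
`Z(l)` and zero a.e. off it, so the range of `T l` is exactly the space of `L²` functions supported
in `Z(l)` (`exists_preimage`).

An operator `A` commuting with all `T l` therefore preserves the functions supported in any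
cylinder; no adjoints are needed. The complement of a cylinder is a countable union of cylinders,
and the sets `B` for which `A` respects both `B` and `Bᶜ` form a σ-algebra, so `A` is local for
every Borel set. By σ-finiteness a local bounded operator is multiplication by a bounded `h`
(`exists_mul_of_preservesSupport`). Comparing `T l A` with `A T l` on a nowhere vanishing function
gives `h ∘ σ^{d(l)} = h` on `Z(l)`, and the cylinders of a fixed degree cover the space. The
converse is a computation, and the invariant multipliers are closed under adjoints, so adding the
operators `(T l)*` does not change the commutant.

The projection onto a reducing subspace lies in the commutant, so it is multiplication by the
indicator of a set invariant under all shifts. Joint ergodicity makes it `0` or `1`, and ergodicity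
of a single shift implies joint ergodicity. -/

theorem eLpNorm_two_sq_eq_lintegral {X : Type*} [MeasurableSpace X] (ν : Measure X) (f : X → ℂ) :
    eLpNorm f 2 ν ^ 2 = ∫⁻ x, ‖f x‖ₑ ^ 2 ∂ν := by
  have := eLpNorm_nnreal_pow_eq_lintegral (μ := ν) (f := f) (p := 2) two_ne_zero
  norm_num at this
  exact_mod_cast this

theorem memLp_two_iff_lintegral_lt_top {X : Type*} [MeasurableSpace X] {ν : Measure X} {f : X → ℂ}
    (hf : AEStronglyMeasurable f ν) : MemLp f 2 ν ↔ ∫⁻ x, ‖f x‖ₑ ^ 2 ∂ν < ∞ := by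
  rw [← eLpNorm_two_sq_eq_lintegral]
  exact ⟨fun h => ENNReal.pow_lt_top h.2, fun h => ⟨hf, by simpa using h⟩⟩

namespace MeasureTheory.Lp

variable {X : Type*} [MeasurableSpace X] {ν : Measure X}

theorem enorm_sq_eq_lintegral (f : Lp ℂ 2 ν) : ‖f‖ₑ ^ 2 = ∫⁻ x, ‖f x‖ₑ ^ 2 ∂ν := by
  rw [Lp.enorm_def, eLpNorm_two_sq_eq_lintegral]

/-- The product of `g` with the indicator function of `B`. -/
noncomputable def cut (B : Set X) (hB : MeasurableSet B) (g : Lp ℂ 2 ν) : Lp ℂ 2 ν :=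
  ((Lp.memLp g).indicator hB).toLp _

theorem coeFn_cut (B : Set X) (hB : MeasurableSet B) (g : Lp ℂ 2 ν) :
    cut B hB g =ᵐ[ν] B.indicator g := MemLp.coeFn_toLp _

theorem cut_add_cut_compl (B : Set X) (hB : MeasurableSet B) (g : Lp ℂ 2 ν) :
    cut B hB g + cut Bᶜ hB.compl g = g := by
  refine Lp.ext ?_
  filter_upwards [Lp.coeFn_add (cut B hB g) (cut Bᶜ hB.compl g), coeFn_cut B hB g,
    coeFn_cut Bᶜ hB.compl g] with x h1 h2 h3
  rw [h1, Pi.add_apply, h2, h3]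
  by_cases hx : x ∈ B <;> simp [hx]

theorem inner_eq_zero_of_disjoint (f g : Lp ℂ 2 ν) (h : ∀ᵐ x ∂ν, f x = 0 ∨ g x = 0) :
    inner ℂ f g = 0 := by
  rw [L2.inner_def]
  refine integral_eq_zero_of_ae ?_
  filter_upwards [h] with x hx
  rcases hx with hx | hx <;> simp [hx]

/-- Cutting is an orthogonal projection, so this inner product is the squared norm of the cut; it
turns vanishing on a set into an orthogonality statement. -/
theorem inner_cut_cut (B : Set X) (hB : MeasurableSet B) (f : Lp ℂ 2 ν) :
    inner ℂ f (cut B hB f) = inner ℂ (cut B hB f) (cut B hB f) := by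
  conv_lhs => rw [← cut_add_cut_compl B hB f, inner_add_left]
  rw [cut_add_cut_compl, inner_eq_zero_of_disjoint (cut Bᶜ hB.compl f), add_zero]
  filter_upwards [coeFn_cut B hB f, coeFn_cut Bᶜ hB.compl f] with x h2 h3
  rw [h2, h3]
  by_cases hx : x ∈ B <;> simp [hx]

theorem cut_eq_zero_iff (B : Set X) (hB : MeasurableSet B) (f : Lp ℂ 2 ν) :
    cut B hB f = 0 ↔ ∀ᵐ x ∂ν, x ∈ B → f x = 0 := by
  rw [Lp.eq_zero_iff_ae_eq_zero]
  constructor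
  · intro h
    filter_upwards [h, coeFn_cut B hB f] with x h1 h2 hx
    rw [h2, indicator_of_mem hx] at h1
    exact h1
  · intro h
    filter_upwards [h, coeFn_cut B hB f] with x h1 h2
    rw [h2]
    by_cases hx : x ∈ B <;> simp [hx, h1]

/-- The operator `A` maps functions that vanish off `B` to functions that vanish off `B`. -/
def PreservesSupport (A : Lp ℂ 2 ν →L[ℂ] Lp ℂ 2 ν) (B : Set X) : Prop :=
  ∀ g : Lp ℂ 2 ν, (∀ᵐ x ∂ν, x ∉ B → g x = 0) → ∀ᵐ x ∂ν, x ∉ B → A g x = 0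

/-- Duality avoids making the sets disjoint or summing a series. Let `p` be the part of `A g` off
the union and `φ = A* p`. The inner product of `φ` with its own cut to `B i` equals that of `p` with
`A` of this cut, which is zero because the latter lives on `B i`. So `φ` vanishes on the union,
hence is orthogonal to `g`, and `‖p‖² = ⟨A g, p⟩ = ⟨g, φ⟩ = 0`. -/
theorem PreservesSupport.iUnion {A : Lp ℂ 2 ν →L[ℂ] Lp ℂ 2 ν} {ι : Type*} [Countable ι]
    {B : ι → Set X} (hB : ∀ i, MeasurableSet (B i)) (h : ∀ i, PreservesSupport A (B i)) :
    PreservesSupport A (⋃ i, B i) := by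
  intro g hg
  have hU : MeasurableSet (⋃ i, B i)ᶜ := (MeasurableSet.iUnion hB).compl
  set p := cut _ hU (A g) with hp
  set φ := ContinuousLinearMap.adjoint A p with hφ
  have hp0 : ∀ᵐ x ∂ν, x ∈ ⋃ i, B i → p x = 0 := by
    filter_upwards [coeFn_cut _ hU (A g)] with x hx hxU
    rw [hp, hx, indicator_of_notMem (by simpa using hxU)]
  have hφ0 : ∀ i, ∀ᵐ x ∂ν, x ∈ B i → φ x = 0 := by
    intro i
    rw [← cut_eq_zero_iff _ (hB i), ← inner_self_eq_zero (𝕜 := ℂ), ← inner_cut_cut, hφ,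
      ContinuousLinearMap.adjoint_inner_left]
    refine inner_eq_zero_of_disjoint _ _ ?_
    have := h i (cut _ (hB i) φ) (by
      filter_upwards [coeFn_cut _ (hB i) φ] with x hx hxB
      rw [hx, indicator_of_notMem hxB])
    filter_upwards [this, hp0] with x h1 h2
    by_cases hx : x ∈ B i
    · exact Or.inl (h2 (mem_iUnion_of_mem i hx))
    · exact Or.inr (h1 hx)
  have hin : inner ℂ (A g) p = 0 := by
    rw [← inner_conj_symm, ← ContinuousLinearMap.adjoint_inner_left, ← hφ,
      inner_eq_zero_of_disjoint φ g, map_zero]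
    filter_upwards [ae_all_iff.2 hφ0, hg] with x h1 h2
    by_cases hx : x ∈ ⋃ i, B i
    · obtain ⟨i, hi⟩ := mem_iUnion.1 hx
      exact Or.inl (h1 i hi)
    · exact Or.inr (h2 hx)
  rw [hp, inner_cut_cut, inner_self_eq_zero, cut_eq_zero_iff] at hin
  exact hin

theorem PreservesSupport.iInter {A : Lp ℂ 2 ν →L[ℂ] Lp ℂ 2 ν} {ι : Type*} [Countable ι]
    {B : ι → Set X} (h : ∀ i, PreservesSupport A (B i)) :
    PreservesSupport A (⋂ i, B i) := by
  intro g hg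
  have : ∀ i, ∀ᵐ x ∂ν, x ∉ B i → A g x = 0 := fun i => h i g (by
    filter_upwards [hg] with x hx hxi
    exact hx fun hx' => hxi (mem_iInter.1 hx' i))
  filter_upwards [ae_all_iff.2 this] with x hx hxi
  obtain ⟨i, hi⟩ := not_forall.1 (fun hh => hxi (mem_iInter.2 hh))
  exact hx i hi

/-- The induction carries `B` and `Bᶜ` together, since preserving the support in one does not give
it for the other. Countable unions need `iUnion` for the set and `iInter` for its complement. -/
theorem PreservesSupport.of_generateFrom {A : Lp ℂ 2 ν →L[ℂ] Lp ℂ 2 ν} {C : Set (Set X)}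
    (hC : ‹MeasurableSpace X› = MeasurableSpace.generateFrom C)
    (h : ∀ B ∈ C, PreservesSupport A B ∧ PreservesSupport A Bᶜ) {B : Set X}
    (hB : MeasurableSet B) : PreservesSupport A B := by
  suffices H : MeasurableSet B ∧ PreservesSupport A B ∧ PreservesSupport A Bᶜ from H.2.1
  rw [hC] at hB
  induction B, hB using MeasurableSpace.generateFrom_induction with
  | hC t ht ht' => exact ⟨by rw [hC]; exact ht', h t ht⟩
  | empty =>
    refine ⟨.empty, fun g hg => ?_, fun g _ => by simp⟩
    have : g = 0 := (Lp.eq_zero_iff_ae_eq_zero).2 (hg.mono fun x hx => hx (notMem_empty x))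
    rw [this, map_zero]
    filter_upwards [Lp.coeFn_zero ℂ 2 ν] with x hx _ using hx
  | compl t _ ht => exact ⟨ht.1.compl, ht.2.2, by rw [compl_compl]; exact ht.2.1⟩
  | iUnion s _ hs =>
    refine ⟨.iUnion fun i => (hs i).1, .iUnion (fun i => (hs i).1) fun i => (hs i).2.1, ?_⟩
    rw [compl_iUnion]
    exact .iInter fun i => (hs i).2.2

theorem PreservesSupport.map_cut {A : Lp ℂ 2 ν →L[ℂ] Lp ℂ 2 ν} {B : Set X} (hB : MeasurableSet B)
    (h : PreservesSupport A B) (h' : PreservesSupport A Bᶜ) (g : Lp ℂ 2 ν) :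
    A (cut B hB g) =ᵐ[ν] B.indicator (A g) := by
  have e : A (cut B hB g) + A (cut Bᶜ hB.compl g) = A g := by
    rw [← map_add, cut_add_cut_compl]
  have h1 := h (cut B hB g) (by
    filter_upwards [coeFn_cut B hB g] with x hx hxB
    rw [hx, indicator_of_notMem hxB])
  have h2 := h' (cut Bᶜ hB.compl g) (by
    filter_upwards [coeFn_cut Bᶜ hB.compl g] with x hx hxB
    rw [hx, indicator_of_notMem hxB])
  have h3 := Lp.coeFn_add (A (cut B hB g)) (A (cut Bᶜ hB.compl g))
  rw [e] at h3
  filter_upwards [h1, h2, h3] with x h1 h2 h3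
  by_cases hx : x ∈ B
  · rw [indicator_of_mem hx, h3, Pi.add_apply, h2 (by simpa using hx), add_zero]
  · rw [indicator_of_notMem hx, h1 hx]

/-! ### Multiplication operators -/

theorem exists_mulOperator {h : X → ℂ} (hh : MemLp h ∞ ν) :
    ∃ M : Lp ℂ 2 ν →L[ℂ] Lp ℂ 2 ν, ∀ g : Lp ℂ 2 ν, M g =ᵐ[ν] fun x => h x * g x := by
  refine ⟨(ContinuousLinearMap.mul ℂ ℂ).holderL ν ∞ 2 2 (hh.toLp h), fun g => ?_⟩
  have := (ContinuousLinearMap.mul ℂ ℂ).coeFn_holder (r := 2) (hh.toLp h) g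
  filter_upwards [this, hh.coeFn_toLp] with x h1 h2
  rw [← h2]
  exact h1

/-- By σ-finiteness there is a strictly positive function with finite integral; its square root is
`w`. Such a `w` determines a multiplier by division, and its cuts span a dense subspace. -/
theorem exists_pos_memLp_two [SigmaFinite ν] : ∃ w : Lp ℂ 2 ν, ∀ᵐ x ∂ν, w x ≠ 0 := by
  obtain ⟨w, hpos, hm, hw⟩ := exists_pos_lintegral_lt_of_sigmaFinite ν (one_ne_zero (α := ℝ≥0∞))
  have hmW : Measurable fun x => ((NNReal.sqrt (w x) : ℝ) : ℂ) := by fun_prop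
  have hW : MemLp (fun x => ((NNReal.sqrt (w x) : ℝ) : ℂ)) 2 ν := by
    rw [memLp_two_iff_lintegral_lt_top hmW.aestronglyMeasurable]
    refine lt_of_eq_of_lt (lintegral_congr fun x => ?_) (hw.trans ENNReal.one_lt_top)
    rw [← ofReal_norm, Complex.norm_real, Real.norm_of_nonneg (NNReal.coe_nonneg _),
      ENNReal.ofReal_coe_nnreal, ← ENNReal.coe_pow, NNReal.sq_sqrt]
  refine ⟨hW.toLp _, ?_⟩
  filter_upwards [hW.coeFn_toLp] with x hx
  rw [hx]
  simpa using (hpos x).ne'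

/-- An operator that is local with respect to all measurable sets is a multiplication operator. -/
theorem exists_mul_of_preservesSupport [SigmaFinite ν] {A : Lp ℂ 2 ν →L[ℂ] Lp ℂ 2 ν}
    (hA : ∀ B, MeasurableSet B → PreservesSupport A B) :
    ∃ h : X → ℂ, MemLp h ∞ ν ∧ ∀ g : Lp ℂ 2 ν, A g =ᵐ[ν] fun x => h x * g x := by
  obtain ⟨w, hw⟩ := exists_pos_memLp_two (ν := ν)
  have hcut : ∀ B (hB : MeasurableSet B), A (cut B hB w) =ᵐ[ν] B.indicator (A w) := fun B hB =>
    (hA B hB).map_cut hB (hA _ hB.compl) w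
  -- The only possible multiplier, as `A w = h w` and `w` has no zeros a.e.
  set h : X → ℂ := fun x => A w x / w x with hh
  have hhm : AEStronglyMeasurable h ν :=
    ((Lp.aestronglyMeasurable _).aemeasurable.div
      (Lp.aestronglyMeasurable _).aemeasurable).aestronglyMeasurable
  have hsq : ∀ B, MeasurableSet B → ∀ g k : Lp ℂ 2 ν, g =ᵐ[ν] B.indicator k →
      ‖g‖ₑ ^ 2 = ∫⁻ x in B, ‖k x‖ₑ ^ 2 ∂ν := by
    intro B hB g k hg
    rw [enorm_sq_eq_lintegral, ← lintegral_indicator hB]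
    refine lintegral_congr_ae ?_
    filter_upwards [hg] with x hx
    rw [hx]
    by_cases hxB : x ∈ B <;> simp [hxB]
  -- Integrated over `B` this is the operator norm bound for the cut of `w` to `B`, by locality;
  -- having it for every `B` gives the pointwise inequality, hence `‖h‖ ≤ ‖A‖` a.e.
  have hle : ∀ᵐ x ∂ν, ‖A w x‖ₑ ^ 2 ≤ ‖A‖ₑ ^ 2 * ‖w x‖ₑ ^ 2 := by
    have hm1 : Measurable fun x => ‖A w x‖ₑ ^ 2 :=
      (Lp.stronglyMeasurable (A w)).enorm.pow_const 2
    have hm2 : Measurable fun x => ‖A‖ₑ ^ 2 * ‖w x‖ₑ ^ 2 :=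
      ((Lp.stronglyMeasurable w).enorm.pow_const 2).const_mul _
    refine ae_le_of_forall_setLIntegral_le_of_sigmaFinite hm1 fun B hB _ => ?_
    rw [lintegral_const_mul _ ((Lp.stronglyMeasurable w).enorm.pow_const 2),
      ← hsq B hB _ _ (hcut B hB), ← hsq B hB _ _ (coeFn_cut B hB w), ← mul_pow]
    gcongr
    exact A.le_opENorm _
  have hbd : ∀ᵐ x ∂ν, ‖h x‖ ≤ ‖A‖ := by
    filter_upwards [hle, hw] with x hx hwx
    rw [← mul_pow, ENNReal.pow_le_pow_left_iff two_ne_zero, ← ofReal_norm, ← ofReal_norm,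
      ← ofReal_norm, ← ENNReal.ofReal_mul (norm_nonneg _),
      ENNReal.ofReal_le_ofReal_iff (by positivity)] at hx
    rw [hh, norm_div]
    exact (div_le_iff₀ (norm_pos_iff.2 hwx)).2 hx
  have hmem : MemLp h ∞ ν := memLp_top_of_bound hhm _ hbd
  obtain ⟨M, hM⟩ := exists_mulOperator hmem
  -- Density of the cuts of `w`, in dual form: `A` and `M` agree on these cuts, so every `φ` in the
  -- range of `(A - M)*` is orthogonal to all of them. Then `⟨φ x, w x⟩` has zero integral over
  -- every `B`, and `φ = 0` since `w` has no zeros a.e.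
  have hAM : A = M := by
    rw [← sub_eq_zero, ← map_eq_zero_iff ContinuousLinearMap.adjoint
      (LinearIsometryEquiv.injective _)]
    ext1 ψ
    rw [_root_.zero_apply]
    set φ := ContinuousLinearMap.adjoint (A - M) ψ with hφ
    have hint : ∀ B, MeasurableSet B → ∫ x in B, inner ℂ (φ x) (w x) ∂ν = 0 := by
      intro B hB
      have e : A (cut B hB w) = M (cut B hB w) := by
        refine Lp.ext ?_
        filter_upwards [hcut B hB, hM (cut B hB w), coeFn_cut B hB w, hw] with x h1 h2 h3 h4
        rw [h1, h2, h3]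
        by_cases hx : x ∈ B
        · simp [hx, hh, h4]
        · simp [hx]
      have e2 : inner ℂ φ (cut B hB w) = 0 := by
        rw [hφ, ContinuousLinearMap.adjoint_inner_left, _root_.sub_apply, e, sub_self,
          inner_zero_right]
      rw [← e2, L2.inner_def, ← integral_indicator hB]
      refine integral_congr_ae ?_
      filter_upwards [coeFn_cut B hB w] with x hx
      rw [hx]
      by_cases hxB : x ∈ B <;> simp [hxB]
    have := (L2.integrable_inner (𝕜 := ℂ) φ w).ae_eq_zero_of_forall_setIntegral_eq_zero
      fun B hB _ => hint B hB
    refine (Lp.eq_zero_iff_ae_eq_zero).2 ?_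
    filter_upwards [this, hw] with x h1 h2
    simpa [h2] using h1
  exact ⟨h, hmem, fun g => by rw [hAM]; exact hM g⟩

end MeasureTheory.Lp

/-! ### Shifts, prefixes and cylinder sets -/

namespace KGraph

variable {k : ℕ} {Λ : KGraph.{u} k}

theorem InfPath.seg_congr (x : Λ.InfPath) {p q p' q' : Fin k → ℕ} (hp : p = p') (hq : q = q')
    (h : p ≤ q) (h' : p' ≤ q') : x.seg p q h = x.seg p' q' h' := by
  subst hp hq
  rfl

theorem mem_cylinder_seg (x : Λ.InfPath) (n : Fin k → ℕ) :
    x ∈ Λ.cylinder (x.seg 0 n zero_le) :=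
  x.seg_congr rfl (by rw [x.d_seg, tsub_zero]) _ _

theorem d_seg_zero (x : Λ.InfPath) (n : Fin k → ℕ) : Λ.d (x.seg 0 n zero_le) = n := by
  rw [x.d_seg, tsub_zero]

theorem eq_of_mem_cylinder {x : Λ.InfPath} {l m : Λ.Mor} (hl : x ∈ Λ.cylinder l)
    (hm : x ∈ Λ.cylinder m) (h : Λ.d l = Λ.d m) : l = m :=
  Eq.trans (Eq.symm hl) ((x.seg_congr rfl h _ _).trans hm)

theorem shift_mem_cylinder {x : Λ.InfPath} {l : Λ.Mor} (hx : x ∈ Λ.cylinder l) :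
    Λ.shift (Λ.d l) x ∈ Λ.cylinder (Λ.s l) := by
  have hx' : x.seg 0 (Λ.d l) zero_le = l := hx
  have h : x.seg (Λ.d l) (Λ.d l) le_rfl = Λ.s l := by rw [← x.s_seg 0 _ zero_le, hx']
  exact (x.seg_congr (zero_add _) ((congrArg (· + Λ.d l) (Λ.d_s l)).trans (zero_add _)) _ _).trans h

/-- Unique factorization of `x(0, q) = x(0, p) x(p, q)` recovers every segment from the initial
ones. -/
theorem InfPath.ext_seg_zero {x y : Λ.InfPath}
    (h : ∀ q, x.seg 0 q zero_le = y.seg 0 q zero_le) : x = y := by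
  refine InfPath.ext fun p q hpq => ?_
  have e : ∀ z : Λ.InfPath, Λ.s (z.seg 0 p zero_le) = Λ.r (z.seg p q hpq) := fun z => by
    rw [z.s_seg, z.r_seg]
  refine (Λ.comp_inj (h := e x) (h' := e y) ?_ ?_).2
  · rw [x.seg_comp 0 p q zero_le hpq, y.seg_comp 0 p q zero_le hpq, h]
  · rw [h]

theorem concat_shift {x : Λ.InfPath} {l : Λ.Mor} (hx : x ∈ Λ.cylinder l) :
    Λ.concat l (Λ.shift (Λ.d l) x) (shift_mem_cylinder hx) = x := by
  have hx' : x.seg 0 (Λ.d l) zero_le = l := hx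
  refine InfPath.ext_seg_zero fun q => ?_
  refine (Λ.ofHeads_seg_zero _ _ _ q).trans ?_
  have e : ∀ p (hp : p ≤ q + Λ.d l),
      Λ.s (x.seg 0 p zero_le) = Λ.r (x.seg p (q + Λ.d l) hp) := fun p hp => by
    rw [x.s_seg, x.r_seg]
  -- The finite path `l (σ^{d(l)} x)(0, q)` is `x(0, q + d(l))`, whose initial segment of degree `q`
  -- is `x(0, q)`.
  refine (Λ.head_eq _ (e q le_self_add) ?_ (d_seg_zero x q)).1
  rw [x.seg_comp 0 q _ zero_le le_self_add, ← x.seg_comp 0 (Λ.d l) _ zero_le le_add_self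
    (e _ le_add_self)]
  have h2 : (Λ.shift (Λ.d l) x).seg 0 q zero_le = x.seg (Λ.d l) (q + Λ.d l) le_add_self :=
    x.seg_congr (zero_add _) rfl _ _
  unfold extend
  congr 1
  exact h2.symm

theorem prefixMap_shift {x : Λ.InfPath} {l : Λ.Mor} (hx : x ∈ Λ.cylinder l) :
    Λ.prefixMap l (Λ.shift (Λ.d l) x) = x := by
  rw [prefixMap, dif_pos (shift_mem_cylinder hx), concat_shift hx]

theorem prefixMap_mem {x : Λ.InfPath} {l : Λ.Mor} (hx : x ∈ Λ.cylinder (Λ.s l)) :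
    Λ.prefixMap l x ∈ Λ.cylinder l := by
  rw [prefixMap, dif_pos hx]
  exact Λ.concat_mem l x hx

theorem prefixMap_image_preimage (l : Λ.Mor) (B : Set Λ.InfPath) :
    Λ.prefixMap l '' (Λ.cylinder (Λ.s l) ∩ Λ.prefixMap l ⁻¹' B) = Λ.cylinder l ∩ B := by
  ext x
  constructor
  · rintro ⟨y, ⟨hy, hyB⟩, rfl⟩
    exact ⟨prefixMap_mem hy, hyB⟩
  · rintro ⟨hx, hxB⟩
    refine ⟨_, ⟨shift_mem_cylinder hx, ?_⟩, prefixMap_shift hx⟩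
    rwa [mem_preimage, prefixMap_shift hx]

theorem measurableSet_cylinder (l : Λ.Mor) : MeasurableSet (Λ.cylinder l) :=
  IsOpen.measurableSet (TopologicalSpace.isOpen_generateFrom_of_mem (mem_range_self l))

/-- Countability of `Λ` makes the cylinder subbasis countable, so the topology is second countable
and its subbasis generates the Borel sets. -/
theorem measurableSpace_eq_generateFrom (Λ : KGraph.{u} k) :
    (inferInstance : MeasurableSpace Λ.InfPath) =
      MeasurableSpace.generateFrom (Set.range Λ.cylinder) := by
  have := Λ.countable_mor
  have : SecondCountableTopology Λ.InfPath := ⟨⟨_, countable_range _, rfl⟩⟩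
  exact borel_eq_generateFrom_of_subbasis rfl

/-- Each path has exactly one initial segment of degree `d(l)`. This is what gives locality of the
commutant on complements of cylinders. -/
theorem compl_cylinder (l : Λ.Mor) :
    (Λ.cylinder l)ᶜ = ⋃ m : {m : Λ.Mor // Λ.d m = Λ.d l ∧ m ≠ l}, Λ.cylinder m.1 := by
  ext x
  simp only [mem_compl_iff, mem_iUnion, Subtype.exists, exists_prop]
  constructor
  · intro hx
    refine ⟨x.seg 0 (Λ.d l) zero_le, ⟨d_seg_zero x _, fun h => hx h⟩, mem_cylinder_seg x _⟩
  · rintro ⟨m, ⟨hd, hne⟩, hm⟩ hx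
    exact hne (eq_of_mem_cylinder hm hx hd)

theorem sigmaFinite_of_cylinder_lt_top {μ : Measure Λ.InfPath} (h : ∀ l, μ (Λ.cylinder l) < ∞) :
    SigmaFinite μ := by
  have := Λ.countable_mor
  refine Measure.sigmaFinite_of_countable (countable_range Λ.cylinder) ?_ ?_
  · rintro _ ⟨l, rfl⟩
    exact h l
  · exact sUnion_range Λ.cylinder ▸ iUnion_eq_univ_iff.2 fun x => ⟨_, mem_cylinder_seg x 0⟩

end KGraph

/-! ### Projective systems on the infinite path space -/

namespace IsLambdaProjective

open KGraph

variable {k : ℕ} {Λ : KGraph.{u} k} {μ : Measure Λ.InfPath} {f : Λ.Mor → Λ.InfPath → ℂ}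

theorem measurable_shift
    (hproj : IsLambdaProjective Λ μ (fun l => Λ.cylinder (Λ.s l)) Λ.prefixMap Λ.shift f)
    (n : Fin k → ℕ) : Measurable (Λ.shift n) :=
  (hproj.semibranching n).measurable_coding

theorem measurable_prefixMap
    (hproj : IsLambdaProjective Λ μ (fun l => Λ.cylinder (Λ.s l)) Λ.prefixMap Λ.shift f)
    (l : Λ.Mor) : Measurable (Λ.prefixMap l) := by
  refine measurable_of_restrict_of_restrict_compl (measurableSet_cylinder (Λ.s l))
    ((hproj.semibranching (Λ.d l)).measurable_τ ⟨l, rfl⟩) ?_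
  have : (Λ.cylinder (Λ.s l))ᶜ.domRestrict (Λ.prefixMap l) = Subtype.val := by
    funext x
    exact dif_neg x.2
  rw [this]
  exact measurable_subtype_coe

/-- Change of variables: `|f l|² μ` is the image under `σ_l` of `μ` restricted to `Z(s(l))`, and
`σ^{d(l)}` undoes `σ_l`. -/
theorem lintegral_mul_comp_shift
    (hproj : IsLambdaProjective Λ μ (fun l => Λ.cylinder (Λ.s l)) Λ.prefixMap Λ.shift f)
    (l : Λ.Mor) {φ : Λ.InfPath → ℝ≥0∞} (hφ : Measurable φ) :
    ∫⁻ x, ‖f l x‖ₑ ^ 2 * φ (Λ.shift (Λ.d l) x) ∂μ = ∫⁻ x in Λ.cylinder (Λ.s l), φ x ∂μ := by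
  have hτ := hproj.measurable_prefixMap l
  have hf : AEMeasurable (fun x => ‖f l x‖ₑ ^ 2) μ :=
    (hproj.memLp l).aestronglyMeasurable.enorm.pow_const 2
  have hφσ : Measurable fun x => φ (Λ.shift (Λ.d l) x) := hφ.comp (hproj.measurable_shift _)
  have e : (μ.restrict (Λ.cylinder (Λ.s l))).map (Λ.prefixMap l) =
      μ.withDensity fun x => ‖f l x‖ₑ ^ 2 := by
    ext B hB
    rw [Measure.map_apply hτ hB, Measure.restrict_apply (hτ hB), withDensity_apply _ hB,
      ← hproj.rnDeriv l B hB, inter_comm]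
  have h := lintegral_withDensity_eq_lintegral_mul₀ hf hφσ.aemeasurable
  rw [← e, lintegral_map hφσ hτ] at h
  refine h.symm.trans (setLIntegral_congr_fun (measurableSet_cylinder _) fun x hx => ?_)
  rw [(hproj.semibranching (Λ.d l)).coding ⟨l, rfl⟩ x hx]

/-- The map `σ_l` never lands outside `Z(l)`, so the density `|f l|²` has zero integral there. -/
theorem ae_eq_zero_off
    (hproj : IsLambdaProjective Λ μ (fun l => Λ.cylinder (Λ.s l)) Λ.prefixMap Λ.shift f)
    (l : Λ.Mor) : ∀ᵐ x ∂μ, x ∉ Λ.cylinder l → f l x = 0 := by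
  have hm := measurableSet_cylinder l
  have h := hproj.rnDeriv l _ hm.compl
  have h0 : Λ.cylinder (Λ.s l) ∩ Λ.prefixMap l ⁻¹' (Λ.cylinder l)ᶜ = ∅ := by
    rw [← image_eq_empty (f := Λ.prefixMap l), prefixMap_image_preimage, inter_compl_self]
  rw [h0, measure_empty, eq_comm, lintegral_eq_zero_iff'
    ((hproj.memLp l).aestronglyMeasurable.enorm.pow_const 2).restrict] at h
  filter_upwards [(ae_restrict_iff' hm.compl).1 h] with x hx hxl
  simpa using hx hxl

/-- The zero set `B` of `f l` has a null preimage under `σ_l`, because `|f l|²` is the density. The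
measure `μ ∘ σ_l` is absolutely continuous, so the image of this preimage, which is `Z(l) ∩ B`, is
null as well. -/
theorem ae_ne_zero_on
    (hproj : IsLambdaProjective Λ μ (fun l => Λ.cylinder (Λ.s l)) Λ.prefixMap Λ.shift f)
    (l : Λ.Mor) : ∀ᵐ x ∂μ, x ∈ Λ.cylinder l → f l x ≠ 0 := by
  have hfm := (hproj.memLp l).aestronglyMeasurable
  have hτ := hproj.measurable_prefixMap l
  set B : Set Λ.InfPath := {x | hfm.mk _ x = 0} with hBdef
  have hB : MeasurableSet B := hfm.stronglyMeasurable_mk.measurable (measurableSet_singleton 0)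
  obtain ⟨Φ, -, hΦ, -⟩ := (hproj.semibranching (Λ.d l)).rnDeriv_pos ⟨l, rfl⟩
  have h0 : μ (Λ.cylinder (Λ.s l) ∩ Λ.prefixMap l ⁻¹' B) = 0 := by
    rw [hproj.rnDeriv l B hB]
    refine (setLIntegral_congr_fun_ae hB ?_).trans lintegral_zero
    filter_upwards [hfm.ae_eq_mk] with x hx hxB
    rw [hx, show hfm.mk _ x = 0 from hxB]
    simp
  have h1 := hΦ _ ((measurableSet_cylinder (Λ.s l)).inter (hτ hB)) inter_subset_left
  change μ (Λ.prefixMap l '' _) = _ at h1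
  rw [prefixMap_image_preimage, Measure.restrict_eq_zero.2 h0, lintegral_zero_measure] at h1
  filter_upwards [measure_eq_zero_iff_ae_notMem.1 h1, hfm.ae_eq_mk] with x hx1 hx2 hxl hx0
  exact hx1 ⟨hxl, hx2.symm.trans hx0⟩

/-- On `Z(l)` with `d(l) = n` the shift inverts `σ_l`, so the preimage of a null set `N` there is
the `σ_l`-image of `Z(s(l)) ∩ N`, null by absolute continuity of `μ ∘ σ_l`. Countably many such
cylinders cover the space. -/
theorem quasiMeasurePreserving_shift
    (hproj : IsLambdaProjective Λ μ (fun l => Λ.cylinder (Λ.s l)) Λ.prefixMap Λ.shift f)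
    (n : Fin k → ℕ) : Measure.QuasiMeasurePreserving (Λ.shift n) μ μ := by
  have := Λ.countable_mor
  have hσ := hproj.measurable_shift n
  refine ⟨hσ, Measure.AbsolutelyContinuous.mk fun N hN hN0 => ?_⟩
  rw [Measure.map_apply hσ hN, measure_eq_zero_iff_ae_notMem]
  have h : ∀ l, Λ.d l = n → ∀ᵐ x ∂μ, x ∈ Λ.cylinder l → x ∉ Λ.shift n ⁻¹' N := by
    rintro l rfl
    obtain ⟨Φ, -, hΦ, -⟩ := (hproj.semibranching (Λ.d l)).rnDeriv_pos ⟨l, rfl⟩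
    have h1 := hΦ (Λ.cylinder (Λ.s l) ∩ N) ((measurableSet_cylinder (Λ.s l)).inter hN)
      inter_subset_left
    rw [Measure.restrict_eq_zero.2 (measure_mono_null inter_subset_right hN0),
      lintegral_zero_measure] at h1
    filter_upwards [measure_eq_zero_iff_ae_notMem.1 h1] with x hx hxl hxN
    exact hx ⟨_, ⟨shift_mem_cylinder hxl, hxN⟩, prefixMap_shift hxl⟩
  have h' : ∀ l : {l : Λ.Mor // Λ.d l = n}, ∀ᵐ x ∂μ, x ∈ Λ.cylinder l.1 → x ∉ Λ.shift n ⁻¹' N :=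
    fun l => h l.1 l.2
  filter_upwards [ae_all_iff.2 h'] with x hx
  exact hx ⟨_, d_seg_zero x n⟩ (mem_cylinder_seg x n)

variable {E : Set Λ.InfPath}

theorem ae_mem_shift_iff {n : Fin k → ℕ} (hinv : IsInvariantSet μ (Λ.shift n) E) :
    ∀ᵐ x ∂μ, Λ.shift n x ∈ E ↔ x ∈ E := by
  filter_upwards [measure_symmDiff_eq_zero_iff.1 hinv] with x hx
  exact hx.to_iff

theorem quasiMeasurePreserving_shift_restrict
    (hproj : IsLambdaProjective Λ μ (fun l => Λ.cylinder (Λ.s l)) Λ.prefixMap Λ.shift f)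
    {n : Fin k → ℕ} (hinv : IsInvariantSet μ (Λ.shift n) E) :
    Measure.QuasiMeasurePreserving (Λ.shift n) (μ.restrict E) (μ.restrict E) := by
  have h : μ.restrict E = μ.restrict (Λ.shift n ⁻¹' E) :=
    Measure.restrict_congr_set (measure_symmDiff_eq_zero_iff.1 hinv).symm
  nth_rw 1 [h]
  exact (hproj.quasiMeasurePreserving_shift n).restrict fun x hx => hx

/-- The unrestricted formula applied to `1_E φ`, where invariance replaces `1_E ∘ σ^{d(l)}` by
`1_E`. -/
theorem lintegral_mul_comp_shift_restrict
    (hproj : IsLambdaProjective Λ μ (fun l => Λ.cylinder (Λ.s l)) Λ.prefixMap Λ.shift f)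
    (hE : MeasurableSet E) (l : Λ.Mor) (hinv : IsInvariantSet μ (Λ.shift (Λ.d l)) E)
    {φ : Λ.InfPath → ℝ≥0∞} (hφ : Measurable φ) :
    ∫⁻ x in E, ‖f l x‖ₑ ^ 2 * φ (Λ.shift (Λ.d l) x) ∂μ =
      ∫⁻ x in Λ.cylinder (Λ.s l), φ x ∂μ.restrict E := by
  rw [← lintegral_indicator hE, Measure.restrict_restrict (measurableSet_cylinder _),
    inter_comm, ← Measure.restrict_restrict hE, ← lintegral_indicator hE,
    ← hproj.lintegral_mul_comp_shift l (hφ.indicator hE)]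
  refine lintegral_congr_ae ?_
  filter_upwards [ae_mem_shift_iff hinv] with x hx
  by_cases hxE : x ∈ E
  · simp [hxE, hx.2 hxE]
  · simp [hxE, mt hx.1 hxE]

/-! ### The operators of the restricted system -/

theorem lintegral_enorm_mul_comp_shift
    (hproj : IsLambdaProjective Λ μ (fun l => Λ.cylinder (Λ.s l)) Λ.prefixMap Λ.shift f)
    (hE : MeasurableSet E) (l : Λ.Mor) (hinv : IsInvariantSet μ (Λ.shift (Λ.d l)) E)
    {g : Λ.InfPath → ℂ} (hg : Measurable g) :
    ∫⁻ x in E, ‖f l x * g (Λ.shift (Λ.d l) x)‖ₑ ^ 2 ∂μ =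
      ∫⁻ x in Λ.cylinder (Λ.s l), ‖g x‖ₑ ^ 2 ∂μ.restrict E := by
  rw [← hproj.lintegral_mul_comp_shift_restrict hE l hinv (hg.enorm.pow_const 2)]
  exact lintegral_congr fun x => by rw [enorm_mul, mul_pow]

theorem aestronglyMeasurable_mul_comp_shift
    (hproj : IsLambdaProjective Λ μ (fun l => Λ.cylinder (Λ.s l)) Λ.prefixMap Λ.shift f)
    (l : Λ.Mor) (g : Lp ℂ 2 (μ.restrict E)) :
    AEStronglyMeasurable (fun x => f l x * g (Λ.shift (Λ.d l) x)) (μ.restrict E) :=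
  (hproj.memLp l).aestronglyMeasurable.restrict.mul
    (((Lp.stronglyMeasurable g).comp_measurable (hproj.measurable_shift _)).aestronglyMeasurable)

theorem memLp_mul_comp_shift
    (hproj : IsLambdaProjective Λ μ (fun l => Λ.cylinder (Λ.s l)) Λ.prefixMap Λ.shift f)
    (hE : MeasurableSet E) (l : Λ.Mor) (hinv : IsInvariantSet μ (Λ.shift (Λ.d l)) E)
    (g : Lp ℂ 2 (μ.restrict E)) :
    MemLp (fun x => f l x * g (Λ.shift (Λ.d l) x)) 2 (μ.restrict E) := by
  rw [memLp_two_iff_lintegral_lt_top (hproj.aestronglyMeasurable_mul_comp_shift l g),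
    hproj.lintegral_enorm_mul_comp_shift hE l hinv (Lp.stronglyMeasurable g).measurable]
  exact (setLIntegral_le_lintegral _ _).trans_lt
    ((memLp_two_iff_lintegral_lt_top (Lp.aestronglyMeasurable g)).1 (Lp.memLp g))

theorem exists_rep
    (hproj : IsLambdaProjective Λ μ (fun l => Λ.cylinder (Λ.s l)) Λ.prefixMap Λ.shift f)
    (hE : MeasurableSet E) (hinv : ∀ n, IsInvariantSet μ (Λ.shift n) E) :
    ∃ T : Λ.Mor → (Lp ℂ 2 (μ.restrict E) →L[ℂ] Lp ℂ 2 (μ.restrict E)),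
      IsLambdaProjectiveRep Λ (μ.restrict E) Λ.shift f T := by
  suffices H : ∀ l, ∃ S : Lp ℂ 2 (μ.restrict E) →L[ℂ] Lp ℂ 2 (μ.restrict E),
      ∀ g : Lp ℂ 2 (μ.restrict E),
        S g =ᵐ[μ.restrict E] fun x => f l x * g (Λ.shift (Λ.d l) x) by
    choose T hT using H
    exact ⟨T, hT⟩
  intro l
  have hmem := hproj.memLp_mul_comp_shift hE l (hinv _)
  have hq := hproj.quasiMeasurePreserving_shift_restrict (hinv (Λ.d l))
  let S : Lp ℂ 2 (μ.restrict E) →ₗ[ℂ] Lp ℂ 2 (μ.restrict E) :=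
    { toFun := fun g => (hmem g).toLp _
      map_add' := fun g₁ g₂ => by
        rw [← MemLp.toLp_add]
        refine MemLp.toLp_congr _ _ ?_
        -- An a.e. identity may be composed with the shift because preimages of null sets are null.
        filter_upwards [hq.ae_eq_comp (Lp.coeFn_add g₁ g₂)] with x hx
        simp only [Function.comp_apply, Pi.add_apply] at hx ⊢
        rw [hx, mul_add]
      map_smul' := fun c g => by
        rw [RingHom.id_apply, ← MemLp.toLp_const_smul]
        refine MemLp.toLp_congr _ _ ?_
        filter_upwards [hq.ae_eq_comp (Lp.coeFn_smul c g)] with x hx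
        simp only [Function.comp_apply, Pi.smul_apply, smul_eq_mul] at hx ⊢
        rw [hx]
        ring }
  -- The norm is at most `1`: the squared norm of the image is the integral of `|g|²` over `Z(s(l))`
  -- only.
  refine ⟨S.mkContinuous 1 fun g => ?_, fun g => (hmem g).coeFn_toLp⟩
  have h : ‖S g‖ₑ ^ 2 ≤ ‖g‖ₑ ^ 2 := by
    rw [Lp.enorm_sq_eq_lintegral, Lp.enorm_sq_eq_lintegral]
    calc ∫⁻ x in E, ‖S g x‖ₑ ^ 2 ∂μ
        = ∫⁻ x in E, ‖f l x * g (Λ.shift (Λ.d l) x)‖ₑ ^ 2 ∂μ := by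
          refine lintegral_congr_ae ?_
          filter_upwards [(hmem g).coeFn_toLp] with x hx
          rw [← hx]
          rfl
      _ = _ := hproj.lintegral_enorm_mul_comp_shift hE l (hinv _)
          (Lp.stronglyMeasurable g).measurable
      _ ≤ _ := setLIntegral_le_lintegral _ _
  rw [ENNReal.pow_le_pow_left_iff two_ne_zero, enorm_le_iff_norm_le] at h
  rwa [one_mul]

/-- The preimage is `(G / f l) ∘ σ_l` on `Z(s(l))`, extended by zero. It is square integrable by the
isometry identity read backwards, since its image under the formula for `T l` is `G`. A measurable
representative of `f l` keeps the composition with `σ_l` measurable. -/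
theorem exists_preimage
    (hproj : IsLambdaProjective Λ μ (fun l => Λ.cylinder (Λ.s l)) Λ.prefixMap Λ.shift f)
    (hE : MeasurableSet E) (l : Λ.Mor) (hinv : IsInvariantSet μ (Λ.shift (Λ.d l)) E)
    {S : Lp ℂ 2 (μ.restrict E) →L[ℂ] Lp ℂ 2 (μ.restrict E)}
    (hS : ∀ g : Lp ℂ 2 (μ.restrict E),
      S g =ᵐ[μ.restrict E] fun x => f l x * g (Λ.shift (Λ.d l) x))
    (G : Lp ℂ 2 (μ.restrict E)) (hG : ∀ᵐ x ∂μ.restrict E, x ∉ Λ.cylinder l → G x = 0) :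
    ∃ g, S g = G := by
  have hfm := (hproj.memLp l).aestronglyMeasurable
  set f' := hfm.mk (f l) with hf'
  set g : Λ.InfPath → ℂ := (Λ.cylinder (Λ.s l)).indicator
    fun x => G (Λ.prefixMap l x) / f' (Λ.prefixMap l x) with hg
  have hgm : Measurable g :=
    (((Lp.stronglyMeasurable G).measurable.div hfm.stronglyMeasurable_mk.measurable).comp
      (hproj.measurable_prefixMap l)).indicator (measurableSet_cylinder _)
  have hq := hproj.quasiMeasurePreserving_shift_restrict hinv
  have key : ∀ᵐ x ∂μ.restrict E, f l x * g (Λ.shift (Λ.d l) x) = G x := by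
    filter_upwards [ae_restrict_of_ae hfm.ae_eq_mk, ae_restrict_of_ae (hproj.ae_eq_zero_off l),
      ae_restrict_of_ae (hproj.ae_ne_zero_on l), hG] with x h1 h2 h3 h4
    by_cases hx : x ∈ Λ.cylinder l
    · rw [hg, indicator_of_mem (shift_mem_cylinder hx), prefixMap_shift hx, hf', ← h1,
        mul_div_cancel₀ _ (h3 hx)]
    · rw [h2 hx, h4 hx, zero_mul]
  have hmem : MemLp g 2 (μ.restrict E) := by
    rw [memLp_two_iff_lintegral_lt_top hgm.aestronglyMeasurable]
    have e1 : ∫⁻ x in E, ‖g x‖ₑ ^ 2 ∂μ =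
        ∫⁻ x in Λ.cylinder (Λ.s l), ‖g x‖ₑ ^ 2 ∂μ.restrict E := by
      rw [← lintegral_indicator (measurableSet_cylinder _)]
      refine lintegral_congr fun x => ?_
      by_cases hx : x ∈ Λ.cylinder (Λ.s l) <;> simp [hg, hx]
    rw [e1, ← hproj.lintegral_enorm_mul_comp_shift hE l hinv hgm,
      lintegral_congr_ae (key.mono fun x hx => by rw [hx])]
    exact (memLp_two_iff_lintegral_lt_top (Lp.aestronglyMeasurable G)).1 (Lp.memLp G)
  refine ⟨hmem.toLp g, Lp.ext ?_⟩
  filter_upwards [hS (hmem.toLp g), hq.ae_eq_comp hmem.coeFn_toLp, key] with x h1 h2 h3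
  simp only [Function.comp_apply] at h2
  rw [h1, h2, h3]

/-! ### The commutant -/

/-- A function supported in `Z(l)` has the form `T l g`, and `A (T l g) = T l (A g)` carries the
factor `f l`, which vanishes off `Z(l)`. -/
theorem preservesSupport_cylinder
    (hproj : IsLambdaProjective Λ μ (fun l => Λ.cylinder (Λ.s l)) Λ.prefixMap Λ.shift f)
    (hE : MeasurableSet E) (hinv : ∀ n, IsInvariantSet μ (Λ.shift n) E)
    {T : Λ.Mor → (Lp ℂ 2 (μ.restrict E) →L[ℂ] Lp ℂ 2 (μ.restrict E))}
    (hT : IsLambdaProjectiveRep Λ (μ.restrict E) Λ.shift f T)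
    {A : Lp ℂ 2 (μ.restrict E) →L[ℂ] Lp ℂ 2 (μ.restrict E)}
    (hA : ∀ l g, T l (A g) = A (T l g)) (l : Λ.Mor) :
    Lp.PreservesSupport A (Λ.cylinder l) := by
  intro G hG
  obtain ⟨g, rfl⟩ := hproj.exists_preimage hE l (hinv _) (hT l) G hG
  rw [← hA]
  filter_upwards [hT l (A g), ae_restrict_of_ae (hproj.ae_eq_zero_off l)] with x h1 h2 hx
  rw [h1, h2 hx, zero_mul]

theorem mem_invariantMultiplicationOperators
    (hproj : IsLambdaProjective Λ μ (fun l => Λ.cylinder (Λ.s l)) Λ.prefixMap Λ.shift f)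
    [SigmaFinite μ]
    (hE : MeasurableSet E) (hinv : ∀ n, IsInvariantSet μ (Λ.shift n) E)
    {T : Λ.Mor → (Lp ℂ 2 (μ.restrict E) →L[ℂ] Lp ℂ 2 (μ.restrict E))}
    (hT : IsLambdaProjectiveRep Λ (μ.restrict E) Λ.shift f T)
    {A : Lp ℂ 2 (μ.restrict E) →L[ℂ] Lp ℂ 2 (μ.restrict E)}
    (hA : ∀ l g, T l (A g) = A (T l g)) :
    A ∈ invariantMultiplicationOperators (μ.restrict E) Λ.shift := by
  have := Λ.countable_mor
  have hcyl := hproj.preservesSupport_cylinder hE hinv hT hA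
  have hloc : ∀ B, MeasurableSet B → Lp.PreservesSupport A B := by
    intro B hB
    refine Lp.PreservesSupport.of_generateFrom (measurableSpace_eq_generateFrom Λ) ?_ hB
    rintro _ ⟨l, rfl⟩
    refine ⟨hcyl l, ?_⟩
    rw [KGraph.compl_cylinder]
    exact .iUnion (fun m => measurableSet_cylinder m.1) fun m => hcyl m.1
  obtain ⟨h, hmem, hh⟩ := Lp.exists_mul_of_preservesSupport hloc
  refine ⟨h, hmem, fun n => ?_, hh⟩
  obtain ⟨w, hw⟩ := Lp.exists_pos_memLp_two (ν := μ.restrict E)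
  -- Evaluating `T l (A w) = A (T l w)` gives `f l · (h ∘ σ^n) · (w ∘ σ^n) = h · f l · (w ∘ σ^n)`.
  -- On `Z(l)` the factor `f l · (w ∘ σ^n)` is nonzero a.e. and cancels.
  have H : ∀ l : {l : Λ.Mor // Λ.d l = n}, ∀ᵐ x ∂μ.restrict E,
      x ∈ Λ.cylinder l.1 → h (Λ.shift n x) = h x := by
    rintro ⟨l, rfl⟩
    have hq := hproj.quasiMeasurePreserving_shift_restrict (hinv (Λ.d l))
    have e := hT l (A w)
    rw [hA] at e
    filter_upwards [e, hh (T l w), hT l w, hq.ae_eq_comp (hh w), hq.ae hw,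
      ae_restrict_of_ae (hproj.ae_ne_zero_on l)] with x h1 h2 h3 h4 h5 h6 hx
    simp only [Function.comp_apply] at h4
    rw [h2, h3, h4] at h1
    have h7 := mul_ne_zero (h6 hx) h5
    refine mul_right_cancel₀ h7 ?_
    rw [h1]
    ring
  filter_upwards [ae_all_iff.2 H] with x hx
  exact hx ⟨_, d_seg_zero x n⟩ (mem_cylinder_seg x n)

end IsLambdaProjective

theorem IsLambdaProjectiveRep.commute_of_mem {k : ℕ} {Λ : KGraph.{u} k} {X : Type*}
    [MeasurableSpace X] {ν : Measure X} {σ : (Fin k → ℕ) → X → X} {f : Λ.Mor → X → ℂ}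
    {T : Λ.Mor → (Lp ℂ 2 ν →L[ℂ] Lp ℂ 2 ν)} (hT : IsLambdaProjectiveRep Λ ν σ f T)
    (hσ : ∀ n, Measure.QuasiMeasurePreserving (σ n) ν ν) {A : Lp ℂ 2 ν →L[ℂ] Lp ℂ 2 ν}
    (hA : A ∈ invariantMultiplicationOperators ν σ) (l : Λ.Mor) : T l * A = A * T l := by
  obtain ⟨h, -, hinv, hh⟩ := hA
  ext1 g
  refine Lp.ext ?_
  filter_upwards [hT l (A g), hh (T l g), hT l g, (hσ (Λ.d l)).ae_eq_comp (hh g),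
    hinv (Λ.d l)] with x h1 h2 h3 h4 h5
  simp only [Function.comp_apply] at h4 h5
  change T l (A g) x = A (T l g) x
  rw [h1, h2, h3, h4, h5]
  ring

/-- The adjoint multiplies by the conjugate of `h`, which is invariant too. Commutation with the
operators `(T l)*` is deduced from this. -/
theorem adjoint_mem_invariantMultiplicationOperators {X : Type*} [MeasurableSpace X]
    {ν : Measure X} {ι : Type*} {σ : ι → X → X} {A : Lp ℂ 2 ν →L[ℂ] Lp ℂ 2 ν}
    (hA : A ∈ invariantMultiplicationOperators ν σ) :
    ContinuousLinearMap.adjoint A ∈ invariantMultiplicationOperators ν σ := by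
  obtain ⟨h, hmem, hinv, hh⟩ := hA
  obtain ⟨M, hM⟩ := Lp.exists_mulOperator hmem.star
  refine ⟨star h, hmem.star, fun n => ?_, ?_⟩
  · filter_upwards [hinv n] with x hx
    exact congrArg star hx
  · have : ContinuousLinearMap.adjoint A = M := by
      refine ((ContinuousLinearMap.eq_adjoint_iff M A).2 fun a b => ?_).symm
      rw [L2.inner_def, L2.inner_def]
      refine integral_congr_ae ?_
      filter_upwards [hM a, hh b] with x h1 h2
      rw [h1, h2]
      simp only [RCLike.inner_apply, Pi.star_apply, map_mul, RCLike.star_def, Complex.conj_conj]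
      ring
    rw [this]
    exact hM

/-! ### Irreducibility -/

theorem Submodule.starProjection_commute_of_invariant {H : Type*} [NormedAddCommGroup H]
    [InnerProductSpace ℂ H] [CompleteSpace H] (K : Submodule ℂ H) [K.HasOrthogonalProjection]
    (S : H →L[ℂ] H) (h : ∀ x ∈ K, S x ∈ K ∧ ContinuousLinearMap.adjoint S x ∈ K) (x : H) :
    S (K.starProjection x) = K.starProjection (S x) := by
  refine (Submodule.eq_starProjection_of_mem_orthogonal
    (h _ (K.starProjection_apply_mem x)).1 ?_).symm
  rw [← map_sub, Submodule.mem_orthogonal]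
  intro y hy
  rw [← ContinuousLinearMap.adjoint_inner_left]
  exact Submodule.inner_right_of_mem_orthogonal (h y hy).2
    (K.sub_starProjection_mem_orthogonal x)

/-- The projection onto a reducing subspace commutes with the family, so it multiplies by some
invariant `h`. Idempotence forces `h ∈ {0, 1}`, and ergodicity applies to the set where `h = 1`. -/
theorem isIrreducibleFamily_of_isJointlyErgodic {X : Type*} [MeasurableSpace X] {ν : Measure X}
    [SigmaFinite ν] (hν : ν ≠ 0) {ι κ : Type*} {σ : ι → X → X}
    (hσ : ∀ n, Measure.QuasiMeasurePreserving (σ n) ν ν)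
    {T : κ → (Lp ℂ 2 ν →L[ℂ] Lp ℂ 2 ν)}
    (hcomm : ∀ A : Lp ℂ 2 ν →L[ℂ] Lp ℂ 2 ν, (∀ l g, T l (A g) = A (T l g)) →
      A ∈ invariantMultiplicationOperators ν σ)
    (herg : IsJointlyErgodic ν σ) : IsIrreducibleFamily T := by
  obtain ⟨w, hw⟩ := Lp.exists_pos_memLp_two (ν := ν)
  refine ⟨⟨w, 0, fun h0 => hν ?_⟩, fun K hK hinv => ?_⟩
  · rw [Lp.eq_zero_iff_ae_eq_zero] at h0
    rw [← ae_eq_bot, ← Filter.eventually_false_iff_eq_bot]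
    filter_upwards [h0, hw] with x h1 h2 using h2 h1
  have : CompleteSpace K := hK.completeSpace_coe
  obtain ⟨h, hmem, hh, hP⟩ := hcomm K.starProjection fun l g =>
    K.starProjection_commute_of_invariant (T l) (hinv l) g
  have hsq : ∀ᵐ x ∂ν, h x = 0 ∨ h x = 1 := by
    have e := hP (K.starProjection w)
    rw [Submodule.starProjection_eq_self_iff.2 (K.starProjection_apply_mem w)] at e
    filter_upwards [e, hP w, hw] with x h1 h2 h3
    rw [h2] at h1
    have : h x * (1 - h x) * w x = 0 := by linear_combination h1
    rcases mul_eq_zero.1 (mul_eq_zero.1 this |>.resolve_right h3) with h4 | h4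
    · exact Or.inl h4
    · exact Or.inr (sub_eq_zero.1 h4).symm
  -- A measurable representative is needed for the level set to be measurable;
  -- quasi-measure-preservation transfers the invariance of `h` to it.
  set h' := hmem.1.mk h
  have hh' : h =ᵐ[ν] h' := hmem.1.ae_eq_mk
  have hA : MeasurableSet {x | h' x = 1} :=
    hmem.1.stronglyMeasurable_mk.measurable (measurableSet_singleton 1)
  have hAinv : ∀ n, IsInvariantSet ν (σ n) {x | h' x = 1} := fun n => by
    refine measure_symmDiff_eq_zero_iff.2 ?_
    filter_upwards [hh n, hh', (hσ n).ae_eq_comp hh'] with x h1 h2 h3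
    simp only [Function.comp_apply] at h1 h3
    have : h' (σ n x) = h' x := by rw [← h3, h1, h2]
    exact propext (by change h' (σ n x) = 1 ↔ h' x = 1; rw [this])
  rcases herg {x | h' x = 1} hA hAinv with h0 | h0
  · left
    refine (Submodule.eq_bot_iff _).2 fun g hg => ?_
    rw [← Submodule.starProjection_eq_self_iff.2 hg, Lp.eq_zero_iff_ae_eq_zero]
    filter_upwards [hP g, hsq, hh', measure_eq_zero_iff_ae_notMem.1 h0] with x h1 h2 h3 h4
    rw [h1, h2.resolve_right fun h5 => h4 (h3.symm.trans h5), zero_mul]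
    rfl
  · right
    refine (Submodule.eq_top_iff').2 fun g => ?_
    rw [← Submodule.starProjection_eq_self_iff]
    refine Lp.ext ?_
    filter_upwards [hP g, hh', measure_eq_zero_iff_ae_notMem.1 h0] with x h1 h3 h4
    rw [h1, h3, show h' x = 1 from not_not.1 h4, one_mul]

theorem mainTheorem2 {k : ℕ} (hk : 1 ≤ k) (Λ : KGraph.{u} k) (hne : Nonempty Λ.Mor)
    (hrow : Λ.RowFinite) (hsrc : Λ.SourceFree)
    (μ : Measure Λ.InfPath) (hμ : μ.Regular) (hfin : ∀ l, μ (Λ.cylinder l) < ∞)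
    (f : Λ.Mor → Λ.InfPath → ℂ)
    (hproj : IsLambdaProjective Λ μ (fun l => Λ.cylinder (Λ.s l)) Λ.prefixMap Λ.shift f)
    (E : Set Λ.InfPath) (hE : MeasurableSet E)
    (hinv : ∀ n, IsInvariantSet μ (Λ.shift n) E)
    (hpos : ∀ v, Λ.IsVertex v → μ (E ∩ Λ.cylinder v) ≠ 0) :
    ∃ T : Λ.Mor → (Lp ℂ 2 (μ.restrict E) →L[ℂ] Lp ℂ 2 (μ.restrict E)),
      IsLambdaProjectiveRep Λ (μ.restrict E) Λ.shift f T ∧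
      (Set.centralizer (Set.range T) =
          invariantMultiplicationOperators (μ.restrict E) Λ.shift ∧
        Set.centralizer (Set.range T ∪ Set.range fun l => ContinuousLinearMap.adjoint (T l)) =
          invariantMultiplicationOperators (μ.restrict E) Λ.shift) ∧
      ((∃ n, IsErgodicMap (μ.restrict E) (Λ.shift n)) → IsIrreducibleFamily T) ∧
      (IsJointlyErgodic (μ.restrict E) Λ.shift → IsIrreducibleFamily T) := by
  have := KGraph.sigmaFinite_of_cylinder_lt_top hfin
  obtain ⟨T, hT⟩ := hproj.exists_rep hE hinv
  have hσ := fun n => hproj.quasiMeasurePreserving_shift_restrict (hinv n)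
  have hcomm : ∀ A : Lp ℂ 2 (μ.restrict E) →L[ℂ] Lp ℂ 2 (μ.restrict E),
      (∀ l g, T l (A g) = A (T l g)) →
        A ∈ invariantMultiplicationOperators (μ.restrict E) Λ.shift :=
    fun A hA => hproj.mem_invariantMultiplicationOperators hE hinv hT hA
  have hν : μ.restrict E ≠ 0 := by
    obtain ⟨l⟩ := hne
    intro h0
    refine hpos (Λ.r l) (Λ.d_r l) (measure_mono_null inter_subset_left ?_)
    exact Measure.restrict_eq_zero.1 h0
  have herg : IsJointlyErgodic (μ.restrict E) Λ.shift → IsIrreducibleFamily T :=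
    isIrreducibleFamily_of_isJointlyErgodic hν hσ hcomm
  have hsub : Set.centralizer (Set.range T) ⊆
      invariantMultiplicationOperators (μ.restrict E) Λ.shift := fun A hA =>
    hcomm A fun l g => congrArg (fun S => S g) (hA (T l) (mem_range_self l))
  refine ⟨T, hT, ⟨hsub.antisymm ?_, Subset.antisymm ?_ ?_⟩, ?_, herg⟩
  · rintro A hA _ ⟨l, rfl⟩
    exact hT.commute_of_mem hσ hA l
  · exact (Set.centralizer_subset subset_union_left).trans hsub
  · rintro A hA _ (⟨l, rfl⟩ | ⟨l, rfl⟩)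
    · exact hT.commute_of_mem hσ hA l
    -- Taking adjoints in `T l A* = A* T l` gives `A (T l)* = (T l)* A`.
    · have := congrArg ContinuousLinearMap.adjoint
        (hT.commute_of_mem hσ (adjoint_mem_invariantMultiplicationOperators hA) l)
      simp only [← ContinuousLinearMap.star_eq_adjoint, star_mul, star_star] at this ⊢
      exact this.symm
  · rintro ⟨n, hn⟩
    -- A set invariant under all shifts is invariant under `σ^n`, so ergodicity of one shift gives
    -- joint ergodicity.
    exact herg fun A hA hAinv => hn A hA (hAinv n)
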